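/- Let $G$ be a profinite group which is a CA-group, that is, the centralizer $C_G(g)$ of every element $g \neq 1$ of $G$ is abelian. If $G$ is torsion-free, that is, the identity is its only element of finite order, then either $G$ is abelian or there is a prime $p$ such that $G$ is a pro-$p$ group. -/

import Mathlib

/-- A CA-group: the centralizer of every nontrivial element is abelian. -/
def IsCAGroup (G : Type*) [Group G] : Prop :=
  ∀ g : G, g ≠ 1 → IsMulCommutative (Subgroup.centralizer ({g} : Set G))

/-- A group is torsion-free if its only element of finite order is the identity. -/
def IsTorsionFreeGroup (G : Type*) [Group G] : Prop :=
  ∀ g : G, IsOfFinOrder g → g = 1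

/-- A profinite group is pro-`p` if its quotient by every open normal subgroup
(a finite group) is a `p`-group. -/
def IsProPGroup (p : ℕ) (G : Type*) [Group G] [TopologicalSpace G] : Prop :=
  ∀ N : OpenNormalSubgroup G, IsPGroup p (G ⧸ N.toSubgroup)

/-! In a CA-group, commuting is transitive through nontrivial elements; in a torsion-free one,
powers `y ^ n` with `y ≠ 1`, `n ≠ 0` stay nontrivial. So whatever commutes with such a power
commutes with `y`, and commutation can be tested on powers lying deep in an open subgroup.

Fix a nontrivial pro-`p` element and an open normal `N`, and let `Q` be a `p`-Sylow subgroup of `N`.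
By Frattini, the normalizer of `Q` maps onto `G/N`. Pro-`q` elements of the normalizer with `q ≠ p`
centralize `Q` (`IsProElement.commute_of_mem_normalizer`). If `Q` is not abelian, no such element
except `1` exists and `G/N` is a `p`-group. If `Q` is abelian, its normalizer centralizes it; as `Q
≠ 1`, the normalizer is abelian, hence so is `G/N`. A single nonabelian quotient then forces all
quotients to be `p`-groups. -/

/-! ### Compactness, pro-`q` elements and coprime action. -/

section Profinite

variable {G : Type*} [Group G] [TopologicalSpace G]

/-- The projection of a topological group onto its quotient by an open normal subgroup. -/
abbrev OpenNormalSubgroup.proj (V : OpenNormalSubgroup G) : G →* G ⧸ V.toSubgroup :=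
  QuotientGroup.mk' V.toSubgroup

/-- An element is pro-`q` if its image in every quotient by an open normal subgroup has order
a power of `q`. -/
def IsProElement (q : ℕ) (y : G) : Prop :=
  ∀ W : OpenNormalSubgroup G, ∃ k : ℕ, y ^ q ^ k ∈ W

theorem IsProElement.pow {q : ℕ} {y : G} (hy : IsProElement q y) (n : ℕ) :
    IsProElement q (y ^ n) := fun W => by
  obtain ⟨k, hk⟩ := hy W
  exact ⟨k, by rw [← pow_mul, mul_comm, pow_mul]; exact pow_mem hk n⟩

theorem OpenNormalSubgroup.proj_surjective (V : OpenNormalSubgroup G) :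
    Function.Surjective V.proj :=
  QuotientGroup.mk'_surjective _

theorem OpenNormalSubgroup.proj_eq_one {V : OpenNormalSubgroup G} {x : G} :
    V.proj x = 1 ↔ x ∈ V :=
  QuotientGroup.eq_one_iff x

instance : Nonempty (OpenNormalSubgroup G) :=
  ⟨{ (⊤ : OpenSubgroup G) with
    isNormal' := by change (⊤ : Subgroup G).Normal; infer_instance }⟩

/-- Compactness turns solutions modulo each `V` into one solution in `G`. -/
theorem exists_forall_mem_of_isClosed [CompactSpace G] (F : OpenNormalSubgroup G → Set G)
    (hc : ∀ V, IsClosed (F V)) (hn : ∀ V, (F V).Nonempty)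
    (hmono : ∀ ⦃V W⦄, W ≤ V → F W ⊆ F V) : ∃ x, ∀ V, x ∈ F V := by
  obtain ⟨x, hx⟩ := IsCompact.nonempty_iInter_of_directed_nonempty_isCompact_isClosed F
    (fun V W => ⟨V ⊓ W, hmono inf_le_left, hmono inf_le_right⟩) hn
    (fun V => (hc V).isCompact) hc
  exact ⟨x, fun V => Set.mem_iInter.1 hx V⟩

variable [IsTopologicalGroup G]

theorem OpenNormalSubgroup.isClosed_preimage_proj (V : OpenNormalSubgroup G)
    (T : Set (G ⧸ V.toSubgroup)) : IsClosed {x : G | V.proj x ∈ T} := by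
  have : DiscreteTopology (G ⧸ V.toSubgroup) := QuotientGroup.discreteTopology V.isOpen'
  exact (isClosed_discrete T).preimage QuotientGroup.continuous_mk

theorem OpenNormalSubgroup.isClosed_coe (V : OpenNormalSubgroup G) : IsClosed (V : Set G) :=
  V.toOpenSubgroup.isClosed

variable [CompactSpace G]

instance (V : OpenNormalSubgroup G) : Finite (G ⧸ V.toSubgroup) :=
  Subgroup.quotient_finite_of_isOpen _ V.isOpen'

/-- If `q` divides the order of `x` modulo `V`, then some pro-`q` element of the closed subgroup
generated by `x` lies outside `V`. -/
theorem exists_isProElement_notMem {q : ℕ} (hq : q.Prime) (x : G) (V : OpenNormalSubgroup G)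
    (hx : q ∣ orderOf (V.proj x)) :
    ∃ y ∈ (Subgroup.zpowers x).topologicalClosure, y ∉ V ∧ IsProElement q y := by
  refine (exists_forall_mem_of_isClosed
    (fun W => ((Subgroup.zpowers x).topologicalClosure : Set G) ∩
      {y | V.proj y ∈ ({1}ᶜ : Set (G ⧸ V.toSubgroup))} ∩
      {y | W.proj y ∈ {t : G ⧸ W.toSubgroup | ∃ k : ℕ, t ^ q ^ k = 1}})
    (fun W => ((Subgroup.isClosed_topologicalClosure _).inter (V.isClosed_preimage_proj _)).inter
      (W.isClosed_preimage_proj _)) ?_ ?_).elim fun y hy => ?_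
  rotate_right
  · refine ⟨y, (hy V).1.1, fun h => (hy V).1.2 (OpenNormalSubgroup.proj_eq_one.2 h), fun W => ?_⟩
    obtain ⟨k, hk⟩ := (hy W).2
    exact ⟨k, OpenNormalSubgroup.proj_eq_one.1 (by rw [map_pow]; exact hk)⟩
  · intro W
    obtain ⟨a, m, hm, ham⟩ := Nat.exists_eq_pow_mul_and_not_dvd
      (orderOf_pos (W.proj x)).ne' q hq.ne_one
    -- Here `m` is the prime-to-`q` part of the order of `x` modulo `W`, so `x ^ m` has order `q ^
    -- a` there, while `q ∤ m` keeps it outside `V`.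
    refine ⟨x ^ m, ⟨Subgroup.le_topologicalClosure _
      (Subgroup.npow_mem_zpowers x m), fun h => hm (hx.trans ?_)⟩, a, ?_⟩
    · exact orderOf_dvd_of_pow_eq_one (by rw [← map_pow]; exact h)
    · rw [map_pow, ← pow_mul, mul_comm, ← ham, pow_orderOf_eq_one]
  · rintro U W hWU y ⟨hy, k, hk⟩
    refine ⟨hy, k, ?_⟩
    rw [← map_pow, OpenNormalSubgroup.proj_eq_one] at hk ⊢
    exact hWU hk

variable [TotallyDisconnectedSpace G]

theorem eq_one_of_forall_mem_openNormalSubgroup {x : G}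
    (hx : ∀ V : OpenNormalSubgroup G, x ∈ V) : x = 1 := by
  by_contra h
  obtain ⟨V, hV⟩ := ProfiniteGrp.exist_openNormalSubgroup_sub_open_nhds_of_one
    (isOpen_compl_singleton (x := x)) (by simpa using Ne.symm h)
  exact hV (hx V) rfl

/-- The closed sets `H ∩ xV` are nonempty and directed; a common point agrees with `x` modulo every
`V`, hence equals `x`. -/
theorem mem_of_forall_proj_mem_map {H : Subgroup G} (hH : IsClosed (H : Set G)) {x : G}
    (hx : ∀ V : OpenNormalSubgroup G, V.proj x ∈ H.map V.proj) : x ∈ H := by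
  obtain ⟨h, hh⟩ := exists_forall_mem_of_isClosed
    (fun V => (H : Set G) ∩ {h | V.proj h ∈ ({V.proj x} : Set _)})
    (fun V => hH.inter (V.isClosed_preimage_proj _))
    (fun V => by obtain ⟨h, hh, e⟩ := hx V; exact ⟨h, hh, e⟩)
    (fun V W hWV h hh => ⟨hh.1, QuotientGroup.eq.2 (hWV (QuotientGroup.eq.1 hh.2))⟩)
  have : h⁻¹ * x = 1 := eq_one_of_forall_mem_openNormalSubgroup fun V =>
    QuotientGroup.eq.1 (hh V).2
  rw [← inv_mul_eq_one.1 this]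
  exact (hh (Classical.arbitrary _)).1

/-- Elements of a closed pro-`p` subgroup fixed by a pro-`q` element of `V`, `q ≠ p`, represent
every coset of `V`. -/
theorem exists_commute_of_isProElement {p q : ℕ} (hp : p.Prime) (hq : q.Prime) (hpq : q ≠ p)
    {Q : Subgroup G} (hQ : IsClosed (Q : Set G))
    (hQp : ∀ V : OpenNormalSubgroup G, IsPGroup p (Q.map V.proj)) {z : G}
    (hz : IsProElement q z) (hzQ : z ∈ Subgroup.normalizer (Q : Set G))
    {V : OpenNormalSubgroup G} (hzV : z ∈ V) {s : G} (hs : s ∈ Q) :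
    ∃ t ∈ Q, s⁻¹ * t ∈ V ∧ Commute t z := by
  have := Fact.mk hp
  have := Fact.mk hq
  refine (exists_forall_mem_of_isClosed
    (fun W => (Q : Set G) ∩ {t | V.proj t ∈ ({V.proj s} : Set _)} ∩
      {t | W.proj t ∈ {t : G ⧸ W.toSubgroup | W.proj z * t * (W.proj z)⁻¹ = t}})
    (fun W => (hQ.inter (V.isClosed_preimage_proj _)).inter (W.isClosed_preimage_proj _))
    ?_ ?_).elim fun t ht => ?_
  rotate_right
  · refine ⟨t, (ht V).1.1, QuotientGroup.eq.1 (ht V).1.2.symm, ?_⟩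
    have : (z * t * z⁻¹) * t⁻¹ = 1 := eq_one_of_forall_mem_openNormalSubgroup fun W => by
      rw [← OpenNormalSubgroup.proj_eq_one, map_mul, map_mul, map_mul, map_inv, map_inv,
        (ht W).2, mul_inv_cancel]
    exact (mul_inv_eq_iff_eq_mul.1 (mul_inv_eq_one.1 this)).symm
  · intro U
    set W := U ⊓ V
    obtain ⟨k, hk⟩ := hz W
    let K : Subgroup G := Q ⊓ V.toSubgroup
    -- Since `z ∈ V`, conjugation by `z` preserves the coset `sV ∩ Q`. Modulo `W` this coset has
    -- `p`-power size, so the `q`-group generated by `z` fixes a point of it.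
    let X : Set (G ⧸ W.toSubgroup) := W.proj '' {t | t ∈ Q ∧ s⁻¹ * t ∈ V}
    have hzX : ∀ c ∈ Subgroup.zpowers (W.proj z), ∀ x ∈ X, c * x * c⁻¹ ∈ X := by
      rintro c ⟨n, rfl⟩ _ ⟨t, ⟨htQ, htV⟩, rfl⟩
      refine ⟨z ^ n * t * (z ^ n)⁻¹, ⟨(Subgroup.mem_normalizer_iff.1 (zpow_mem hzQ n) t).1 htQ,
        ?_⟩, by simp⟩
      have h1 : z ^ n ∈ V := zpow_mem hzV n
      have e : V.proj s = V.proj t := QuotientGroup.eq.2 htV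
      rw [← OpenNormalSubgroup.proj_eq_one, map_mul, map_mul, map_mul, map_inv, map_inv,
        OpenNormalSubgroup.proj_eq_one.2 h1, e]
      simp
    let A : MulAction (Subgroup.zpowers (W.proj z)) X :=
      { smul := fun c x => ⟨c.1 * x.1 * c.1⁻¹, hzX c.1 c.2 x.1 x.2⟩
        one_smul := fun x => Subtype.ext (by
          change (1 : G ⧸ W.toSubgroup) * x.1 * 1⁻¹ = x.1
          simp)
        mul_smul := fun c d x => Subtype.ext (by
          change (c.1 * d.1) * x.1 * (c.1 * d.1)⁻¹ = c.1 * (d.1 * x.1 * d.1⁻¹) * c.1⁻¹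
          group) }
    have hXcard : Nat.card X = Nat.card (K.map W.proj) := by
      have : X = (fun g => W.proj s * g) '' (K.map W.proj : Set (G ⧸ W.toSubgroup)) := by
        ext g
        constructor
        · rintro ⟨t, ⟨h1, h2⟩, rfl⟩
          exact ⟨W.proj (s⁻¹ * t), ⟨s⁻¹ * t, ⟨Q.mul_mem (Q.inv_mem hs) h1, h2⟩, rfl⟩, by simp⟩
        · rintro ⟨_, ⟨t, ⟨h1, h2⟩, rfl⟩, rfl⟩
          exact ⟨s * t, ⟨Q.mul_mem hs h1, by
            rw [inv_mul_cancel_left]; exact h2⟩, by simp⟩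
      rw [this, Nat.card_image_of_injective (mul_right_injective _)]
      rfl
    have hXq : ¬ q ∣ Nat.card X := by
      obtain ⟨n, hn⟩ := IsPGroup.iff_card.1
        ((hQp W).to_le (Subgroup.map_mono (inf_le_left : K ≤ Q)))
      rw [hXcard, hn]
      exact fun h => hpq ((Nat.prime_dvd_prime_iff_eq hq hp).1 (hq.dvd_of_dvd_pow h))
    have hzq : IsPGroup q (Subgroup.zpowers (W.proj z)) :=
      IsPGroup.of_card_dvd_pow (n := k) (by
        rw [Nat.card_zpowers]
        exact orderOf_dvd_of_pow_eq_one (by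
          rw [← map_pow]; exact OpenNormalSubgroup.proj_eq_one.2 hk))
    obtain ⟨⟨_, t, ⟨htQ, htV⟩, rfl⟩, hfix⟩ := hzq.nonempty_fixed_point_of_prime_not_dvd_card X hXq
    have h1 : W.proj z * W.proj t * (W.proj z)⁻¹ = W.proj t :=
      congrArg Subtype.val (hfix ⟨W.proj z, Subgroup.mem_zpowers _⟩)
    refine ⟨t, ⟨htQ, (QuotientGroup.eq.2 htV).symm⟩, ?_⟩
    rw [← map_mul, ← map_inv, ← map_mul] at h1
    change U.proj z * U.proj t * (U.proj z)⁻¹ = U.proj t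
    rw [← map_mul, ← map_inv, ← map_mul]
    exact QuotientGroup.eq.2 ((inf_le_left : W ≤ U) (QuotientGroup.eq.1 h1))
  · rintro U W hWU t ⟨ht, h1⟩
    refine ⟨ht, ?_⟩
    change W.proj z * W.proj t * (W.proj z)⁻¹ = W.proj t at h1
    change U.proj z * U.proj t * (U.proj z)⁻¹ = U.proj t
    rw [← map_mul, ← map_inv, ← map_mul] at h1 ⊢
    exact QuotientGroup.eq.2 (hWU (QuotientGroup.eq.1 h1))

end Profinite

/-! ### Sylow subgroups and the Frattini argument. -/

section ProSylow

variable {G : Type*} [Group G] [TopologicalSpace G]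

/-- `Q` is a `p`-Sylow subgroup of the closed subgroup `N` of a profinite group: a closed subgroup
whose images in the finite quotients are Sylow subgroups of the images of `N`. -/
structure IsProSylow (p : ℕ) (Q N : Subgroup G) : Prop where
  isClosed : IsClosed (Q : Set G)
  le : Q ≤ N
  isPGroup : ∀ V : OpenNormalSubgroup G, IsPGroup p (Q.map V.proj)
  not_dvd : ∀ V : OpenNormalSubgroup G, ¬ p ∣ (Q.map V.proj).relIndex (N.map V.proj)

theorem IsProSylow.exists_sylow {p : ℕ} [Fact p.Prime] {Q N : Subgroup G} (h : IsProSylow p Q N)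
    (V : OpenNormalSubgroup G) :
    ∃ P : Sylow p (N.map V.proj),
      (P : Subgroup (N.map V.proj)).map (N.map V.proj).subtype = Q.map V.proj := by
  have h1 : IsPGroup p ((Q.map V.proj).subgroupOf (N.map V.proj)) :=
    (h.isPGroup V).comap_subtype
  refine ⟨h1.toSylow (h.not_dvd V), ?_⟩
  change ((Q.map V.proj).subgroupOf (N.map V.proj)).map (N.map V.proj).subtype = _
  rw [Subgroup.subgroupOf_map_subtype, inf_of_le_left (Subgroup.map_mono h.le)]

variable [IsTopologicalGroup G] [CompactSpace G]

/-- Images in a finite quotient stabilize along the chain, and compactness lifts each point of the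
smallest image to the intersection. This gives the lower bounds for Zorn's lemma. -/
theorem exists_map_le_map_sInf (c : Set (Subgroup G)) (hc : IsChain (· ≤ ·) c) (hne : c.Nonempty)
    (hcl : ∀ H ∈ c, IsClosed (H : Set G)) (V : OpenNormalSubgroup G) :
    ∃ H ∈ c, H.map V.proj ≤ (sInf c).map V.proj := by
  obtain ⟨H, hH, hmin⟩ := exists_minimalFor_of_wellFoundedLT (· ∈ c)
    (fun H : Subgroup G => H.map V.proj) hne
  have hle : ∀ K ∈ c, H.map V.proj ≤ K.map V.proj := fun K hK =>
    (hc.total hH hK).elim (fun h => Subgroup.map_mono h) fun h => hmin hK (Subgroup.map_mono h)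
  refine ⟨H, hH, ?_⟩
  rintro y hy
  have : Nonempty c := ⟨⟨H, hH⟩⟩
  have hcl' : ∀ K : c, IsClosed ((K : Set G) ∩ {x | V.proj x ∈ ({y} : Set _)}) := fun K =>
    (hcl K K.2).inter (V.isClosed_preimage_proj _)
  obtain ⟨x, hx⟩ := IsCompact.nonempty_iInter_of_directed_nonempty_isCompact_isClosed
    (fun K : c => (K : Set G) ∩ {x | V.proj x ∈ ({y} : Set _)})
    (fun K L => (hc.total K.2 L.2).elim
      (fun h => ⟨K, subset_rfl, Set.inter_subset_inter_left _ h⟩)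
      fun h => ⟨L, Set.inter_subset_inter_left _ h, subset_rfl⟩)
    (fun K => by obtain ⟨x, hx, e⟩ := hle K K.2 hy; exact ⟨x, hx, e⟩)
    (fun K => (hcl' K).isCompact) hcl'
  rw [Set.mem_iInter] at hx
  exact ⟨x, Subgroup.mem_sInf.2 fun K hK => (hx ⟨K, hK⟩).1, (hx ⟨H, hH⟩).2⟩

/-- A minimal closed subgroup with all images of index prime to `p` works: if its image modulo `V`
were not a `p`-group, the preimage of a Sylow subgroup of that image would be smaller. -/
theorem exists_isProSylow {p : ℕ} (hp : p.Prime) {N : Subgroup G} (hN : IsClosed (N : Set G)) :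
    ∃ Q : Subgroup G, IsProSylow p Q N := by
  have := Fact.mk hp
  let S : Set (Subgroup G)ᵒᵈ := {H | IsClosed ((OrderDual.ofDual H : Subgroup G) : Set G) ∧
    OrderDual.ofDual H ≤ N ∧ ∀ V : OpenNormalSubgroup G,
      ¬ p ∣ ((OrderDual.ofDual H).map V.proj).relIndex (N.map V.proj)}
  have hNS : OrderDual.toDual N ∈ S :=
    ⟨hN, le_rfl, fun V => by simpa using hp.one_lt.ne'⟩
  obtain ⟨H, -, hHS, hmax⟩ := zorn_le_nonempty₀ S (fun c hcS hc K hK => by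
    have hch : IsChain (· ≤ ·) (OrderDual.ofDual '' c : Set (Subgroup G)) := by
      rintro _ ⟨a, ha, rfl⟩ _ ⟨b, hb, rfl⟩ hab
      exact (hc ha hb (fun e => hab (by rw [e]))).symm
    have hcl : ∀ H ∈ (OrderDual.ofDual '' c : Set (Subgroup G)), IsClosed (H : Set G) := by
      rintro _ ⟨a, ha, rfl⟩
      exact (hcS ha).1
    refine ⟨OrderDual.toDual (sInf (OrderDual.ofDual '' c)), ⟨?_, ?_, fun V => ?_⟩, ?_⟩
    · change IsClosed ((sInf (OrderDual.ofDual '' c : Set (Subgroup G)) : Subgroup G) : Set G)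
      rw [Subgroup.coe_sInf]
      exact isClosed_biInter hcl
    · exact (sInf_le (Set.mem_image_of_mem _ hK)).trans (hcS hK).2.1
    · obtain ⟨_, ⟨a, ha, rfl⟩, hle⟩ := exists_map_le_map_sInf _ hch ⟨_, K, hK, rfl⟩ hcl V
      exact fun h => (hcS ha).2.2 V (h.trans (Subgroup.relIndex_dvd_of_le_left _ hle))
    · exact fun a ha => (sInf_le (Set.mem_image_of_mem _ ha) : sInf _ ≤ OrderDual.ofDual a)) _ hNS
  obtain ⟨hcl, hle, hdvd⟩ := hHS
  set Q : Subgroup G := OrderDual.ofDual H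
  refine ⟨Q, hcl, hle, fun V => ?_, hdvd⟩
  obtain ⟨P⟩ : Nonempty (Sylow p (Q.map V.proj)) := inferInstance
  let P' : Subgroup (G ⧸ V.toSubgroup) := (P : Subgroup (Q.map V.proj)).map (Q.map V.proj).subtype
  let Q' : Subgroup G := Q ⊓ P'.comap V.proj
  have hidx : ¬ p ∣ Q'.relIndex Q := by
    rw [Subgroup.inf_relIndex_left, Subgroup.relIndex_comap, Subgroup.relIndex,
      Subgroup.subgroupOf, Subgroup.comap_map_eq_self_of_injective (Subgroup.subtype_injective _)]
    exact P.not_dvd_index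
  have hQ'S : OrderDual.toDual Q' ∈ S := by
    have hcl' : IsClosed ((P'.comap V.proj : Subgroup G) : Set G) :=
      V.isClosed_preimage_proj (P' : Set (G ⧸ V.toSubgroup))
    refine ⟨hcl.inter hcl', inf_le_left.trans hle,
      fun W => ?_⟩
    change ¬ p ∣ (Q'.map W.proj).relIndex (N.map W.proj)
    rw [← Subgroup.relIndex_mul_relIndex _ (Q.map W.proj) _ (Subgroup.map_mono inf_le_left)
      (Subgroup.map_mono hle), hp.dvd_mul, not_or]
    refine ⟨fun h => hidx (h.trans ?_), hdvd W⟩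
    rw [← Subgroup.relIndex_comap]
    exact Subgroup.relIndex_dvd_of_le_left _ (Subgroup.le_comap_map _ _)
  have hQQ' : Q ≤ Q' := hmax hQ'S (inf_le_left : Q' ≤ Q)
  have hP : IsPGroup p P' := P.isPGroup'.map _
  exact hP.to_le (Subgroup.map_le_iff_le_comap.2 (hQQ'.trans inf_le_right))

variable [TotallyDisconnectedSpace G]

/-- The Frattini argument for a Sylow subgroup of a closed normal subgroup. -/
theorem IsProSylow.exists_mul_mem_normalizer {p : ℕ} (hp : p.Prime) {Q N : Subgroup G} [N.Normal]
    (hN : IsClosed (N : Set G)) (h : IsProSylow p Q N) (g : G) :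
    ∃ n ∈ N, n * g ∈ Subgroup.normalizer (Q : Set G) := by
  have := Fact.mk hp
  have hmem : ∀ {m : G}, (∀ V : OpenNormalSubgroup G,
      V.proj m ∈ Subgroup.normalizer (Q.map V.proj : Set (G ⧸ V.toSubgroup))) →
      m ∈ Subgroup.normalizer (Q : Set G) := by
    intro m hm
    rw [Subgroup.mem_normalizer_iff]
    refine fun x => ⟨fun hx => mem_of_forall_proj_mem_map h.isClosed fun V => ?_,
      fun hx => mem_of_forall_proj_mem_map h.isClosed fun V => ?_⟩
    · simpa using (Subgroup.mem_normalizer_iff.1 (hm V) (V.proj x)).1 (Subgroup.mem_map_of_mem _ hx)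
    · refine (Subgroup.mem_normalizer_iff.1 (hm V) (V.proj x)).2 ?_
      rw [← map_mul, ← map_inv, ← map_mul]
      exact Subgroup.mem_map_of_mem _ hx
  refine (exists_forall_mem_of_isClosed (fun V => (N : Set G) ∩ {n | V.proj n ∈
    {t : G ⧸ V.toSubgroup | t * V.proj g ∈ Subgroup.normalizer
      (Q.map V.proj : Set (G ⧸ V.toSubgroup))}})
    (fun V => hN.inter (V.isClosed_preimage_proj _)) (fun V => ?_) ?_).elim fun n hn => ?_
  · have : (N.map V.proj).Normal := Subgroup.Normal.map inferInstance _ V.proj_surjective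
    obtain ⟨P, hP⟩ := h.exists_sylow V
    have hF := P.normalizer_sup_eq_top
    rw [hP] at hF
    -- Factoring `g⁻¹`, not `g`, as normalizer element times `n` makes `n * g` the inverse of the
    -- normalizer element.
    have hg : V.proj g⁻¹ ∈ Subgroup.normalizer (Q.map V.proj : Set (G ⧸ V.toSubgroup)) ⊔
        N.map V.proj := by rw [hF]; trivial
    obtain ⟨a, ha, _, ⟨n, hn, rfl⟩, e⟩ := Subgroup.mem_sup_of_normal_right.1 hg
    refine ⟨n, hn, ?_⟩
    change V.proj n * V.proj g ∈ Subgroup.normalizer (Q.map V.proj : Set (G ⧸ V.toSubgroup))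
    have : V.proj n * V.proj g = a⁻¹ := by
      rw [eq_inv_iff_mul_eq_one, ← inv_inv (V.proj g), ← map_inv, ← e]
      group
    rw [this]
    exact inv_mem ha
  · rintro V W hWV n ⟨hn, hn'⟩
    refine ⟨hn, ?_⟩
    let f : G ⧸ W.toSubgroup →* G ⧸ V.toSubgroup := QuotientGroup.map _ _ (MonoidHom.id G) hWV
    have hf : Q.map V.proj = (Q.map W.proj).map f := by
      rw [Subgroup.map_map]
      rfl
    change V.proj n * V.proj g ∈ Subgroup.normalizer (Q.map V.proj : Set (G ⧸ V.toSubgroup))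
    rw [hf]
    exact Subgroup.le_normalizer_map f ⟨_, hn', rfl⟩
  · refine ⟨n, (hn (Classical.arbitrary _)).1, hmem fun V => ?_⟩
    rw [map_mul]
    exact (hn V).2

end ProSylow

/-! ### Normalizers of Sylow subgroups in torsion-free CA-groups. -/

section TorsionFreeCA

variable {G : Type*} [Group G]

theorem IsCAGroup.commute (hCA : IsCAGroup G) {a b z : G} (hz : z ≠ 1) (ha : Commute a z)
    (hb : Commute b z) : Commute a b := by
  have := hCA z hz
  have h := this.is_comm.comm (⟨a, Subgroup.mem_centralizer_singleton_iff.2 ha⟩ :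
    Subgroup.centralizer ({z} : Set G)) ⟨b, Subgroup.mem_centralizer_singleton_iff.2 hb⟩
  exact congrArg Subtype.val h

theorem IsTorsionFreeGroup.pow_ne_one (htf : IsTorsionFreeGroup G) {y : G} (hy : y ≠ 1) {n : ℕ}
    (hn : n ≠ 0) : y ^ n ≠ 1 := fun h =>
  hy (htf y (isOfFinOrder_iff_pow_eq_one.2 ⟨n, Nat.pos_of_ne_zero hn, h⟩))

variable [TopologicalSpace G] [IsTopologicalGroup G]

theorem Subgroup.isClosed_normalizer_of_isClosed {H : Subgroup G} (hH : IsClosed (H : Set G)) :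
    IsClosed (Subgroup.normalizer (H : Set G) : Set G) := by
  have : (Subgroup.normalizer (H : Set G) : Set G) =
      (⋂ h ∈ H, {g | g * h * g⁻¹ ∈ (H : Set G)}) ∩ ⋂ h ∈ H, {g | g⁻¹ * h * g ∈ (H : Set G)} := by
    ext g
    simp only [SetLike.mem_coe, Subgroup.mem_normalizer_iff, Set.mem_inter_iff, Set.mem_iInter,
      Set.mem_ofPred_eq]
    refine ⟨fun hg => ⟨fun h => (hg h).1, fun h hh => (hg _).2 (by simpa [mul_assoc] using hh)⟩,
      fun hg h => ⟨hg.1 h, fun hh => by simpa [mul_assoc] using hg.2 _ hh⟩⟩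
  rw [this]
  exact (isClosed_biInter fun h _ => hH.preimage (by fun_prop)).inter
    (isClosed_biInter fun h _ => hH.preimage (by fun_prop))

theorem topologicalClosure_zpowers_le_normalizer {Q : Subgroup G} (hQ : IsClosed (Q : Set G))
    {x : G} (hx : x ∈ Subgroup.normalizer (Q : Set G)) :
    (Subgroup.zpowers x).topologicalClosure ≤ Subgroup.normalizer (Q : Set G) :=
  Subgroup.topologicalClosure_minimal _ (Subgroup.zpowers_le.2 hx)
    (Subgroup.isClosed_normalizer_of_isClosed hQ)

theorem commute_of_mem_topologicalClosure_zpowers [T2Space G] {x y : G}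
    (hy : y ∈ (Subgroup.zpowers x).topologicalClosure) : Commute y x := by
  have : (Subgroup.zpowers x).topologicalClosure ≤ Subgroup.centralizer {x} :=
    Subgroup.topologicalClosure_minimal _
      (Subgroup.zpowers_le.2 (Subgroup.mem_centralizer_singleton_iff.2 rfl))
      (Set.isClosed_centralizer _)
  exact Subgroup.mem_centralizer_singleton_iff.1 (this hy)

variable [CompactSpace G] [TotallyDisconnectedSpace G]

/-- Modulo `V`, adjoining `y` to `Q` gives a `p`-group in which the index of `Q` is both a power of
`p` and prime to `p`. -/
theorem IsProSylow.mem_of_mem_normalizer {p : ℕ} (hp : p.Prime) {Q N : Subgroup G}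
    (h : IsProSylow p Q N) {y : G} (hy : IsProElement p y) (hyN : y ∈ N)
    (hyQ : y ∈ Subgroup.normalizer (Q : Set G)) : y ∈ Q := by
  have := Fact.mk hp
  refine mem_of_forall_proj_mem_map h.isClosed fun V => ?_
  have hyp : IsPGroup p (Subgroup.zpowers (V.proj y)) := by
    obtain ⟨k, hk⟩ := hy V
    refine IsPGroup.of_card_dvd_pow (n := k) ?_
    rw [Nat.card_zpowers]
    exact orderOf_dvd_of_pow_eq_one (by rw [← map_pow]; exact OpenNormalSubgroup.proj_eq_one.2 hk)
  have hnorm : Subgroup.zpowers (V.proj y) ≤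
      Subgroup.normalizer (Q.map V.proj : Set (G ⧸ V.toSubgroup)) := by
    rw [Subgroup.zpowers_le]
    exact Subgroup.le_normalizer_map V.proj ⟨y, hyQ, rfl⟩
  set R := Q.map V.proj ⊔ Subgroup.zpowers (V.proj y)
  have hR : IsPGroup p R := (h.isPGroup V).to_sup_of_normal_left' hyp hnorm
  have hRN : R ≤ N.map V.proj :=
    sup_le (Subgroup.map_mono h.le) (Subgroup.zpowers_le.2 ⟨y, hyN, rfl⟩)
  obtain ⟨n, hn⟩ := hR.index ((Q.map V.proj).subgroupOf R)
  have hdvd := h.not_dvd V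
  rw [← Subgroup.relIndex_mul_relIndex _ R _ le_sup_left hRN, hp.dvd_mul, not_or] at hdvd
  have hn0 : n = 0 := by
    by_contra hn0
    exact hdvd.1 (by rw [Subgroup.relIndex, hn]; exact dvd_pow_self p hn0)
  have hone : (Q.map V.proj).relIndex R = 1 := by rw [Subgroup.relIndex, hn, hn0, pow_zero]
  exact Subgroup.relIndex_eq_one.1 hone
    ((le_sup_right : _ ≤ R) (Subgroup.mem_zpowers (V.proj y)))

theorem exists_prime_isProElement {x : G} (hx : x ≠ 1) :
    ∃ q : ℕ, q.Prime ∧ ∃ y ∈ (Subgroup.zpowers x).topologicalClosure, y ≠ 1 ∧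
      IsProElement q y := by
  obtain ⟨V, hV⟩ : ∃ V : OpenNormalSubgroup G, x ∉ V := by
    by_contra! h
    exact hx (eq_one_of_forall_mem_openNormalSubgroup h)
  obtain ⟨q, hq, hdvd⟩ := Nat.exists_prime_and_dvd (n := orderOf (V.proj x))
    (fun h => hV (OpenNormalSubgroup.proj_eq_one.1 (orderOf_eq_one_iff.1 h)))
  obtain ⟨y, hy, hyV, hyq⟩ := exists_isProElement_notMem hq x V hdvd
  exact ⟨q, hq, y, hy, fun h => hyV (h ▸ one_mem V), hyq⟩

variable [T2Space G]

/-- In a torsion-free profinite CA-group, coprime action is trivial. -/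
theorem IsProElement.commute_of_mem_normalizer (hCA : IsCAGroup G) (htf : IsTorsionFreeGroup G)
    {p q : ℕ} (hp : p.Prime) (hq : q.Prime) (hpq : q ≠ p) {Q : Subgroup G}
    (hQ : IsClosed (Q : Set G)) (hQp : ∀ V : OpenNormalSubgroup G, IsPGroup p (Q.map V.proj))
    {y : G} (hy : IsProElement q y) (hyQ : y ∈ Subgroup.normalizer (Q : Set G)) {s : G}
    (hs : s ∈ Q) : Commute s y := by
  rcases eq_or_ne y 1 with rfl | hy1
  · exact Commute.one_right s
  suffices s ∈ Subgroup.centralizer {y} from Subgroup.mem_centralizer_singleton_iff.1 this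
  refine mem_of_forall_proj_mem_map (Set.isClosed_centralizer _) fun V => ?_
  obtain ⟨k, hk⟩ := hy V
  -- The power `y ^ q ^ k` lies in `V`, and `t` commutes with it, hence with `y`.
  obtain ⟨t, -, hst, ht⟩ := exists_commute_of_isProElement hp hq hpq hQ hQp (hy.pow (q ^ k))
    (pow_mem hyQ _) hk hs
  rw [show V.proj s = V.proj t from QuotientGroup.eq.2 hst]
  exact Subgroup.mem_map_of_mem _ (Subgroup.mem_centralizer_singleton_iff.2
    (hCA.commute (htf.pow_ne_one hy1 (pow_ne_zero k hq.ne_zero)) ht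
      ((Commute.refl y).pow_right _)))

/-- A pro-`q` element `y ≠ 1` in the closure of `⟨x⟩` links `s` to `x`. For `q = p`, a power of `y`
falls into the abelian group `Q`; otherwise the action is coprime. -/
theorem IsProSylow.commute_of_mem_normalizer (hCA : IsCAGroup G) (htf : IsTorsionFreeGroup G)
    {p : ℕ} (hp : p.Prime) {Q : Subgroup G} {N : OpenNormalSubgroup G}
    (h : IsProSylow p Q N.toSubgroup) (hcomm : ∀ s ∈ Q, ∀ t ∈ Q, Commute s t) {x : G}
    (hx : x ∈ Subgroup.normalizer (Q : Set G)) {s : G} (hs : s ∈ Q) : Commute s x := by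
  rcases eq_or_ne x 1 with rfl | hx1
  · exact Commute.one_right s
  obtain ⟨q, hq, y, hy, hy1, hyq⟩ := exists_prime_isProElement hx1
  have hyQ := topologicalClosure_zpowers_le_normalizer h.isClosed hx hy
  refine hCA.commute hy1 ?_ (commute_of_mem_topologicalClosure_zpowers hy).symm
  rcases eq_or_ne q p with rfl | hqp
  · obtain ⟨k, hk⟩ := hyq N
    have hyk := h.mem_of_mem_normalizer hq (hyq.pow (q ^ k)) hk (pow_mem hyQ _)
    exact hCA.commute (htf.pow_ne_one hy1 (pow_ne_zero k hq.ne_zero)) (hcomm s hs _ hyk)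
      ((Commute.refl y).pow_right _)
  · exact hyq.commute_of_mem_normalizer hCA htf hp hq hqp h.isClosed h.isPGroup hyQ hs

/-- Another prime dividing the order of `x` modulo `V` would yield a nontrivial element centralizing
`Q`, making `Q` abelian. -/
theorem exists_pow_mem_of_mem_normalizer (hCA : IsCAGroup G) (htf : IsTorsionFreeGroup G)
    {p : ℕ} (hp : p.Prime) {Q : Subgroup G} (hQ : IsClosed (Q : Set G))
    (hQp : ∀ V : OpenNormalSubgroup G, IsPGroup p (Q.map V.proj))
    (hcomm : ¬ ∀ s ∈ Q, ∀ t ∈ Q, Commute s t) {x : G}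
    (hx : x ∈ Subgroup.normalizer (Q : Set G)) (V : OpenNormalSubgroup G) :
    ∃ k : ℕ, x ^ p ^ k ∈ V := by
  have hord : ∀ {q : ℕ}, q.Prime → q ∣ orderOf (V.proj x) → q = p := by
    intro q hq hdvd
    by_contra hqp
    obtain ⟨y, hy, hyV, hyq⟩ := exists_isProElement_notMem hq x V hdvd
    have hyQ := topologicalClosure_zpowers_le_normalizer hQ hx hy
    have hsy : ∀ s ∈ Q, Commute s y := fun s hs =>
      hyq.commute_of_mem_normalizer hCA htf hp hq hqp hQ hQp hyQ hs
    have hy1 : y ≠ 1 := fun h => hyV (h ▸ one_mem V)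
    exact hcomm fun s hs t ht => hCA.commute hy1 (hsy s hs) (hsy t ht)
  refine ⟨(orderOf (V.proj x)).primeFactorsList.length, OpenNormalSubgroup.proj_eq_one.1 ?_⟩
  rw [map_pow, ← Nat.eq_prime_pow_of_unique_prime_dvd (orderOf_pos (V.proj x)).ne' hord,
    pow_orderOf_eq_one]

/-- A finite quotient of a torsion-free profinite CA-group with a nontrivial pro-`p` element is
a `p`-group or abelian. -/
theorem forall_exists_pow_mem_or_forall_proj_commute (hCA : IsCAGroup G)
    (htf : IsTorsionFreeGroup G) {p : ℕ} (hp : p.Prime) {h : G} (h1 : h ≠ 1)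
    (hh : IsProElement p h) (N : OpenNormalSubgroup G) :
    (∀ g : G, ∃ k : ℕ, g ^ p ^ k ∈ N) ∨ ∀ a b : G, Commute (N.proj a) (N.proj b) := by
  obtain ⟨Q, hQ⟩ := exists_isProSylow hp (N := N.toSubgroup) N.isClosed_coe
  have hproj : ∀ g : G, ∃ g' ∈ Subgroup.normalizer (Q : Set G), N.proj g' = N.proj g := by
    intro g
    obtain ⟨n, hn, hng⟩ := hQ.exists_mul_mem_normalizer hp N.isClosed_coe g
    exact ⟨n * g, hng, by rw [map_mul, OpenNormalSubgroup.proj_eq_one.2 hn, one_mul]⟩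
  by_cases hcomm : ∀ s ∈ Q, ∀ t ∈ Q, Commute s t
  · right
    intro a b
    obtain ⟨u, hu, hu1⟩ : ∃ u ∈ Q, u ≠ 1 := by
      -- If `Q = 1`, everything normalizes `Q`, so a nontrivial power of `h` inside `N` would lie in
      -- `Q`.
      by_contra! hQ1
      obtain ⟨k, hk⟩ := hh N
      refine htf.pow_ne_one h1 (pow_ne_zero k hp.ne_zero) (hQ1 _
        (hQ.mem_of_mem_normalizer hp (hh.pow (p ^ k)) hk ?_))
      rw [(Subgroup.eq_bot_iff_forall Q).2 hQ1, Subgroup.mem_normalizer_iff]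
      simp
    obtain ⟨a', ha', ea⟩ := hproj a
    obtain ⟨b', hb', eb⟩ := hproj b
    rw [← ea, ← eb]
    exact (hCA.commute hu1 (hQ.commute_of_mem_normalizer hCA htf hp hcomm ha' hu).symm
      (hQ.commute_of_mem_normalizer hCA htf hp hcomm hb' hu).symm).map N.proj
  · left
    intro g
    obtain ⟨g', hg', e⟩ := hproj g
    obtain ⟨k, hk⟩ := exists_pow_mem_of_mem_normalizer hCA htf hp hQ.isClosed hQ.isPGroup hcomm
      hg' N
    refine ⟨k, OpenNormalSubgroup.proj_eq_one.1 ?_⟩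
    rw [map_pow, ← e, ← map_pow]
    exact OpenNormalSubgroup.proj_eq_one.2 hk

end TorsionFreeCA

theorem theoremc (G : Type*) [Group G] [TopologicalSpace G] [IsTopologicalGroup G]
    [CompactSpace G] [T2Space G] [TotallyDisconnectedSpace G]
    (hCA : IsCAGroup G) (htf : IsTorsionFreeGroup G) :
    (∃ p : ℕ, p.Prime ∧ IsProPGroup p G) ∨ IsMulCommutative G := by
  by_cases hG : ∀ x : G, x = 1
  · exact Or.inr ⟨⟨fun a b => by rw [hG a, hG b]⟩⟩
  push Not at hG
  obtain ⟨x, hx⟩ := hG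
  obtain ⟨p, hp, h, -, h1, hh⟩ := exists_prime_isProElement hx
  have key := forall_exists_pow_mem_or_forall_proj_commute hCA htf hp h1 hh
  by_cases hab : ∀ N : OpenNormalSubgroup G, ∀ a b : G, Commute (N.proj a) (N.proj b)
  · refine Or.inr ⟨⟨fun a b => ?_⟩⟩
    refine (inv_mul_eq_one.1 (eq_one_of_forall_mem_openNormalSubgroup fun N =>
      QuotientGroup.eq.1 ?_))
    exact hab N a b
  · left
    push Not at hab
    obtain ⟨M, a, b, hM⟩ := hab
    refine ⟨p, hp, fun N g => ?_⟩
    obtain ⟨g, rfl⟩ := N.proj_surjective g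
    -- The quotient by `N ⊓ M` maps onto the nonabelian `G/M`, so it is a `p`-group, and so is its
    -- image `G/N`.
    rcases key (N ⊓ M) with hpow | hcomm
    · obtain ⟨k, hk⟩ := hpow g
      refine ⟨k, ?_⟩
      rw [← map_pow]
      exact OpenNormalSubgroup.proj_eq_one.2 ((inf_le_left : N ⊓ M ≤ N) hk)
    · exact absurd (QuotientGroup.eq.2 ((inf_le_right : N ⊓ M ≤ M)
        (QuotientGroup.eq.1 (hcomm a b)))) hM
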